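/- Let $X$ be a closed orientable smooth surface of genus $1$, that is, a smooth $2$-manifold that is $C^\infty$-diffeomorphic to the torus $S^1\times S^1$, and let $F\subset X$ be a nonempty finite set. Then there is a minimal $C^\infty$ diffeomorphism $f\colon X\setminus F\to X\setminus F$, that is, a $C^\infty$ diffeomorphism such that for every $x\in X\setminus F$ the full orbit $\{f^n(x): n\in\mathbb Z\}$ is dense in $X\setminus F$. -/

import Mathlib

open scoped Manifold ContDiff

/-- The standard smooth torus `S¹ × S¹`, with the product of the smooth structures of the two
unit circles (the model with corners is `(𝓡 1).prod (𝓡 1)`). -/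
abbrev Torus : Type := Circle × Circle

/-- A smooth surface `X` is a closed orientable surface of genus `1` if it is diffeomorphic
(`C^∞`) to the standard torus. -/
def IsGenusOneSurface (X : Type*) [TopologicalSpace X]
    [ChartedSpace (EuclideanSpace ℝ (Fin 2)) X] : Prop :=
  Nonempty (X ≃ₘ⟮𝓡 2, (𝓡 1).prod (𝓡 1)⟯ Torus)

/-- The punctured surface `X - F`: the complement of a finite set, as an open subset of `X`.
Open subsets carry the induced topology and the induced smooth structure. -/
def punctured (X : Type*) [TopologicalSpace X] [T1Space X] (F : Finset X) :
    TopologicalSpace.Opens X :=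
  ⟨(F : Set X)ᶜ, F.finite_toSet.isClosed.isOpen_compl⟩

/-- A bijection `f` of a topological space is minimal if every full orbit
`{fⁿ(y) : n ∈ ℤ}` is dense. (It is applied to diffeomorphisms only.) -/
def IsMinimalBijection {Y : Type*} [TopologicalSpace Y] (f : Equiv.Perm Y) : Prop :=
  ∀ y : Y, Dense (Set.range fun n : ℤ => (f ^ n) y)

open Set Filter Topology

/-! ### Smooth dependence of integrals on parameters -/

/-! Transport everything to the torus. All but countably many slopes `α` are irrational and such
that no line of slope `α` in the plane meets the lift of `F` twice
(`exists_irrational_linesMeetOnce`). Multiply the constant field `(1, α)` by a smooth speed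
vanishing exactly on `F`. A zero of the speed is not reached in finite time
(`exists_le_transitTime`), so this gives a complete smooth flow off `F`; each orbit contains a
half-line of the linear flow and is therefore dense.

The diffeomorphism is the time-one map. By `Flow.dense_range_int` its orbits are dense unless the
flow has a continuous nonconstant circle-valued eigenfunction: for a minimal closed set `M` of the
time-one map, the times `t` that carry `M` into itself form a closed subgroup of the reals
containing `1`. Either it is everything and `M` is the whole space, or it is cyclic and the time
needed to enter `M` defines an eigenfunction.

A puncture excludes eigenfunctions (`puncturedFlow_no_eigenfunction`). On short orbit segments
passing ever closer to it the endpoints converge off `F`, while the transit time grows continuously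
to infinity; the phase of an eigenfunction would have to converge and to wind forever. -/

theorem hasFDerivAt_integral_param {E H : Type*} [NormedAddCommGroup E] [NormedSpace ℝ E]
    [NormedAddCommGroup H] [NormedSpace ℝ H] {V : Set E} {W : Set ℝ} (hV : IsOpen V)
    (hW : IsOpen W) (hIW : Icc (0 : ℝ) 1 ⊆ W) {h : E × ℝ → H}
    (hh : ContDiffOn ℝ 1 h (V ×ˢ W)) {z : E} (hz : z ∈ V) :
    HasFDerivAt (fun z => ∫ u in (0 : ℝ)..1, h (z, u))
      (∫ u in (0 : ℝ)..1, (fderiv ℝ h (z, u)).comp (ContinuousLinearMap.inl ℝ E ℝ)) z := by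
  have hVW : IsOpen (V ×ˢ W) := hV.prod hW
  have hcont : ContinuousOn
      (fun p : E × ℝ => (fderiv ℝ h p).comp (ContinuousLinearMap.inl ℝ E ℝ)) (V ×ˢ W) :=
    (hh.continuousOn_fderiv_of_isOpen hVW le_rfl).clm_comp continuousOn_const
  have hI : uIcc (0 : ℝ) 1 = Icc 0 1 := uIcc_of_le zero_le_one
  have hslice : ∀ x ∈ V, ContinuousOn (fun u => h (x, u)) (uIcc 0 1) := fun x hx =>
    hh.continuousOn.comp (by fun_prop) fun u hu => ⟨hx, hIW (hI ▸ hu)⟩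
  have hslice' : ContinuousOn
      (fun u => (fderiv ℝ h (z, u)).comp (ContinuousLinearMap.inl ℝ E ℝ)) (uIcc 0 1) :=
    hcont.comp (by fun_prop) fun u hu => ⟨hz, hIW (hI ▸ hu)⟩
  obtain ⟨C, hC⟩ : ∃ C : ℝ, ∀ u ∈ Icc (0 : ℝ) 1,
      ‖(fderiv ℝ h (z, u)).comp (ContinuousLinearMap.inl ℝ E ℝ)‖ < C := by
    obtain ⟨C, hC⟩ := isCompact_Icc.exists_bound_of_continuousOn (hI ▸ hslice')
    exact ⟨C + 1, fun u hu => (hC u hu).trans_lt (lt_add_one C)⟩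
  -- A strict bound at `z` is an open condition, so the tube lemma extends it to a neighbourhood `A`
  -- of `z`, uniformly over the interval; the constant `C` then dominates the derivatives.
  have hO : IsOpen ((V ×ˢ W) ∩ (fun p : E × ℝ =>
      ‖(fderiv ℝ h p).comp (ContinuousLinearMap.inl ℝ E ℝ)‖) ⁻¹' Iio C) :=
    hcont.norm.isOpen_inter_preimage hVW isOpen_Iio
  obtain ⟨A, B, hA, -, hzA, hIB, hAB⟩ := generalized_tube_lemma (s := {z}) isCompact_singleton
    (isCompact_Icc (a := (0 : ℝ)) (b := 1)) hO (by
      rintro ⟨x, u⟩ ⟨rfl, hu⟩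
      exact ⟨⟨hz, hIW hu⟩, hC u hu⟩)
  have hι : ∀ t ∈ uIoc (0 : ℝ) 1, t ∈ Icc (0 : ℝ) 1 := fun t ht => hI ▸ uIoc_subset_uIcc ht
  refine intervalIntegral.hasFDerivAt_integral_of_dominated_of_fderiv_le (s := A)
    (F := fun z u => h (z, u)) (bound := fun _ => C)
    (F' := fun z u => (fderiv ℝ h (z, u)).comp (ContinuousLinearMap.inl ℝ E ℝ))
    (hA.mem_nhds (hzA rfl)) ?_ (hslice z hz).intervalIntegrable ?_ ?_ (by simp) ?_
  · filter_upwards [hV.mem_nhds hz] with x hx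
    exact ((hslice x hx).mono uIoc_subset_uIcc).aestronglyMeasurable measurableSet_uIoc
  · exact (hslice'.mono uIoc_subset_uIcc).aestronglyMeasurable measurableSet_uIoc
  · exact .of_forall fun t ht x hx => (hAB ⟨hx, hIB (hι t ht)⟩).2.le
  · refine .of_forall fun t ht x hx => ?_
    have hm := (hAB (show (x, t) ∈ A ×ˢ B from ⟨hx, hIB (hι t ht)⟩)).1
    exact ((hh.contDiffAt (hVW.mem_nhds hm)).differentiableAt one_ne_zero).hasFDerivAt.comp x
      (hasFDerivAt_prodMk_left x t)

/-- The derivative is again a parameter integral, with values in `E →L[ℝ] H`, so the induction must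
vary `H`; one universe for `E` and `H` makes this possible. -/
theorem contDiffOn_integral_param {E H : Type} [NormedAddCommGroup E] [NormedSpace ℝ E]
    [NormedAddCommGroup H] [NormedSpace ℝ H] {V : Set E} {W : Set ℝ} (hV : IsOpen V)
    (hW : IsOpen W) (hIW : Icc (0 : ℝ) 1 ⊆ W) {h : E × ℝ → H}
    (hh : ContDiffOn ℝ ∞ h (V ×ˢ W)) :
    ContDiffOn ℝ ∞ (fun z => ∫ u in (0 : ℝ)..1, h (z, u)) V := by
  refine contDiffOn_infty.2 fun n => ?_
  induction n generalizing H with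
  | zero =>
    exact contDiffOn_zero.2 fun z hz =>
      (hasFDerivAt_integral_param hV hW hIW (hh.of_le (by simp)) hz).continuousAt.continuousWithinAt
  | succ n ih =>
    have hd := fun z hz => hasFDerivAt_integral_param hV hW hIW (hh.of_le (by simp)) (z := z) hz
    push_cast
    refine (contDiffOn_succ_iff_fderiv_of_isOpen hV).2
      ⟨fun z hz => (hd z hz).differentiableAt.differentiableWithinAt, by simp, ?_⟩
    refine (ih (h := fun p => (fderiv ℝ h p).comp (ContinuousLinearMap.inl ℝ E ℝ)) ?_).congr
      fun z hz => (hd z hz).fderiv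
    exact ((contDiffOn_infty_iff_fderiv_of_isOpen (hV.prod hW)).1 hh).2.clm_comp contDiffOn_const

/-! ### Slowing down a linear flow

For a function `φ ≥ 0` on a normed space and a vector `v`, we describe the flow of the vector field
`φ • v` on the complement of the zeros of `φ`. -/

section SlowFlow

variable {E : Type} [NormedAddCommGroup E] [NormedSpace ℝ E]

/-- The parameters `τ` such that the segment from `z` to `z + τ • v` contains no zero of `φ`. -/
def freeTimes (φ : E → ℝ) (v z : E) : Set ℝ := {τ | ∀ σ ∈ uIcc 0 τ, φ (z + σ • v) ≠ 0}

/-- The time that the flow of `φ • v` needs to go from `z` to `z + τ • v`. -/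
noncomputable def transitTime (φ : E → ℝ) (v z : E) (τ : ℝ) : ℝ :=
  ∫ σ in (0 : ℝ)..τ, (φ (z + σ • v))⁻¹

variable {φ : E → ℝ} {v z : E} {τ σ t : ℝ}

theorem zero_mem_freeTimes (hz : φ z ≠ 0) : (0 : ℝ) ∈ freeTimes φ v z := by
  intro σ hσ
  simp only [uIcc_self, mem_singleton_iff] at hσ
  simpa [hσ] using hz

theorem ne_zero_of_mem_freeTimes (h : τ ∈ freeTimes φ v z) : φ (z + τ • v) ≠ 0 :=
  h τ right_mem_uIcc

theorem freeTimes_of_mem_uIcc (h : τ ∈ freeTimes φ v z) (hσ : σ ∈ uIcc 0 τ) :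
    σ ∈ freeTimes φ v z := fun _ hs => h _ (uIcc_subset_uIcc_left hσ hs)

theorem ordConnected_freeTimes : (freeTimes φ v z).OrdConnected := by
  refine ⟨fun a ha b hb x hx => ?_⟩
  rcases le_total 0 x with h | h
  · exact freeTimes_of_mem_uIcc hb (by rw [uIcc_of_le (h.trans hx.2)]; exact ⟨h, hx.2⟩)
  · exact freeTimes_of_mem_uIcc ha (by rw [uIcc_of_ge (hx.1.trans h)]; exact ⟨hx.1, h⟩)

theorem uIcc_subset_freeTimes (hσ : σ ∈ freeTimes φ v z) (hτ : τ ∈ freeTimes φ v z) :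
    uIcc σ τ ⊆ freeTimes φ v z :=
  ordConnected_freeTimes.uIcc_subset hσ hτ

theorem mem_freeTimes_iff :
    τ ∈ freeTimes φ v z ↔ ∀ u ∈ Icc (0 : ℝ) 1, φ (z + (u * τ) • v) ≠ 0 := by
  have himage : uIcc 0 τ = (fun u : ℝ => u * τ) '' Icc 0 1 := by
    rw [← uIcc_of_le (zero_le_one' ℝ), image_mul_const_uIcc]; simp
  simp only [freeTimes, himage, forall_mem_image, mem_ofPred_eq]

/-- Rescaling to a fixed interval turns the endpoint into a parameter, which gives joint smoothness
in `z` and `τ`. -/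
theorem transitTime_eq : transitTime φ v z τ = τ * ∫ u in (0 : ℝ)..1, (φ (z + (u * τ) • v))⁻¹ := by
  rw [transitTime, ← smul_eq_mul,
    intervalIntegral.smul_integral_comp_mul_right (f := fun σ => (φ (z + σ • v))⁻¹)]
  simp

@[simp] theorem transitTime_zero : transitTime φ v z 0 = 0 := by simp [transitTime]

theorem isOpen_setOf_mem_freeTimes (hφ : Continuous φ) :
    IsOpen {p : E × ℝ | p.2 ∈ freeTimes φ v p.1} := by
  refine isOpen_iff_eventually.2 fun p hp => ?_
  simp only [mem_ofPred_eq, mem_freeTimes_iff] at hp ⊢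
  refine isCompact_Icc.eventually_forall_of_forall_eventually fun u hu => ?_
  have hc : Continuous fun q : (E × ℝ) × ℝ => φ (q.1.1 + (q.2 * q.1.2) • v) := by fun_prop
  exact hc.continuousAt.eventually_ne (hp u hu)

theorem isOpen_freeTimes (hφ : Continuous φ) : IsOpen (freeTimes φ v z) :=
  (isOpen_setOf_mem_freeTimes hφ).preimage (f := fun τ => (z, τ)) (by fun_prop)

theorem contDiffAt_transitTime (hφ : ContDiff ℝ ∞ φ) (h : τ ∈ freeTimes φ v z) :
    ContDiffAt ℝ ∞ (fun p : E × ℝ => transitTime φ v p.1 p.2) (z, τ) := by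
  have hc : Continuous fun q : (E × ℝ) × ℝ => φ (q.1.1 + (q.2 * q.1.2) • v) := by
    have := hφ.continuous; fun_prop
  obtain ⟨V, W, hV, hW, hzV, hIW, hVW⟩ := generalized_tube_lemma (s := {(z, τ)})
    isCompact_singleton (isCompact_Icc (a := (0 : ℝ)) (b := 1))
    (isOpen_ne_fun hc continuous_const) (by
      rintro ⟨_, u⟩ ⟨rfl, hu⟩
      exact mem_freeTimes_iff.1 h u hu)
  have hsm : ContDiffOn ℝ ∞ (fun q : (E × ℝ) × ℝ => (φ (q.1.1 + (q.2 * q.1.2) • v))⁻¹)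
      (V ×ˢ W) := by
    refine ContDiffOn.inv ?_ fun q hq => hVW hq
    exact (hφ.comp (by fun_prop)).contDiffOn
  have := (contDiffOn_integral_param hV hW hIW hsm).contDiffAt (hV.mem_nhds (hzV rfl))
  refine (contDiffAt_snd.mul this).congr_of_eventuallyEq (.of_forall fun p => ?_)
  simp [transitTime_eq]

theorem continuousOn_inv_line (hφ : Continuous φ) :
    ContinuousOn (fun σ : ℝ => (φ (z + σ • v))⁻¹) (freeTimes φ v z) :=
  ContinuousOn.inv₀ (by fun_prop) fun _ hσ => ne_zero_of_mem_freeTimes hσ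

theorem intervalIntegrable_inv_line (hφ : Continuous φ) (hσ : σ ∈ freeTimes φ v z)
    (hτ : τ ∈ freeTimes φ v z) :
    IntervalIntegrable (fun σ : ℝ => (φ (z + σ • v))⁻¹) MeasureTheory.volume σ τ :=
  ((continuousOn_inv_line hφ).mono (uIcc_subset_freeTimes hσ hτ)).intervalIntegrable

theorem zero_mem_of_mem_freeTimes (h : τ ∈ freeTimes φ v z) : (0 : ℝ) ∈ freeTimes φ v z :=
  freeTimes_of_mem_uIcc h left_mem_uIcc

theorem hasDerivAt_transitTime (hφ : Continuous φ) (h : τ ∈ freeTimes φ v z) :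
    HasDerivAt (transitTime φ v z) (φ (z + τ • v))⁻¹ τ := by
  have hn := (isOpen_freeTimes hφ (v := v) (z := z)).mem_nhds h
  refine intervalIntegral.integral_hasDerivAt_right
    (intervalIntegrable_inv_line hφ (zero_mem_of_mem_freeTimes h) h)
    ⟨_, hn, (continuousOn_inv_line hφ).aestronglyMeasurable (isOpen_freeTimes hφ).measurableSet⟩
    ((continuousOn_inv_line hφ).continuousAt hn)

theorem continuousOn_transitTime (hφ : Continuous φ) :
    ContinuousOn (transitTime φ v z) (freeTimes φ v z) := fun _ hτ =>
  (hasDerivAt_transitTime hφ hτ).continuousAt.continuousWithinAt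

theorem strictMonoOn_transitTime (hφ : Continuous φ) (h0 : ∀ z, 0 ≤ φ z) :
    StrictMonoOn (transitTime φ v z) (freeTimes φ v z) := by
  refine strictMonoOn_of_deriv_pos ordConnected_freeTimes.convex (continuousOn_transitTime hφ)
    fun τ hτ => ?_
  have hτ := interior_subset hτ
  rw [(hasDerivAt_transitTime hφ hτ).deriv]
  exact inv_pos.2 ((h0 _).lt_of_ne' (ne_zero_of_mem_freeTimes hτ))

theorem add_mem_freeTimes_iff (h : τ ∈ freeTimes φ v z) :
    τ + σ ∈ freeTimes φ v z ↔ σ ∈ freeTimes φ v (z + τ • v) := by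
  have key : ∀ s : ℝ, z + τ • v + s • v = z + (τ + s) • v := fun s => by
    rw [add_smul, add_assoc]
  constructor
  · intro hσ s hs
    rw [key]
    have hs' : τ + s ∈ uIcc τ (τ + σ) := by
      simpa using (Set.image_const_add_uIcc τ 0 σ ▸ mem_image_of_mem (fun x => τ + x) hs :)
    exact ne_zero_of_mem_freeTimes (uIcc_subset_freeTimes h hσ hs')
  · intro hσ s hs
    rcases uIcc_subset_uIcc_union_uIcc (b := τ) hs with hs | hs
    · exact h s hs
    · have : s - τ ∈ uIcc 0 σ := by
        simpa using (Set.image_sub_const_uIcc τ τ (τ + σ) ▸ mem_image_of_mem (fun x => x - τ) hs :)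
      simpa [key] using hσ _ this

theorem transitTime_add (hφ : Continuous φ) (h : τ ∈ freeTimes φ v z)
    (h' : τ + σ ∈ freeTimes φ v z) :
    transitTime φ v z (τ + σ) = transitTime φ v z τ + transitTime φ v (z + τ • v) σ := by
  have h0 := zero_mem_of_mem_freeTimes h
  have key : ∀ s : ℝ, z + τ • v + s • v = z + (s + τ) • v := fun s => by
    rw [add_smul, add_assoc, add_comm (τ • v)]
  simp only [transitTime, key]
  rw [intervalIntegral.integral_comp_add_right (fun s => (φ (z + s • v))⁻¹)]
  rw [zero_add, add_comm σ τ]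
  exact (intervalIntegral.integral_add_adjacent_intervals (intervalIntegrable_inv_line hφ h0 h)
    (intervalIntegrable_inv_line hφ h h')).symm

/-- Reversing `v` reduces negative times to nonnegative ones. -/
theorem neg_mem_freeTimes_iff : -τ ∈ freeTimes φ v z ↔ τ ∈ freeTimes φ (-v) z := by
  simp [mem_freeTimes_iff]

theorem transitTime_neg : transitTime φ v z (-τ) = -transitTime φ (-v) z τ := by
  simp [transitTime_eq]

/-- Zeros of a nonnegative differentiable function cannot be reached in finite time. -/
theorem exists_le_transitTime (hφ : ContDiff ℝ ∞ φ) (h0 : ∀ z, 0 ≤ φ z) (h1 : ∀ z, φ z ≤ 1)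
    (hz : φ z ≠ 0) (T : ℝ) : ∃ τ ∈ freeTimes φ v z, 0 ≤ τ ∧ T ≤ transitTime φ v z τ := by
  have hc := hφ.continuous
  -- With no zero ahead, `φ ≤ 1` makes the transit time at least the distance covered. Otherwise let
  -- `β` be the first zero.
  by_cases hall : ∀ τ : ℝ, 0 ≤ τ → φ (z + τ • v) ≠ 0
  · have hmem : max T 0 ∈ freeTimes φ v z := fun σ hσ => hall σ (by
      rw [uIcc_of_le (le_max_right _ _)] at hσ; exact hσ.1)
    refine ⟨max T 0, hmem, le_max_right _ _, (le_max_left T 0).trans ?_⟩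
    have hle := intervalIntegral.integral_mono_on (le_max_right T 0)
      (intervalIntegrable_const (c := (1 : ℝ)))
      (intervalIntegrable_inv_line hc (zero_mem_freeTimes hz) hmem)
      fun σ hσ => (one_le_inv₀ ((h0 _).lt_of_ne' (hall σ hσ.1))).2 (h1 _)
    simpa [transitTime] using hle
  push Not at hall
  set S : Set ℝ := Ici 0 ∩ {τ | φ (z + τ • v) = 0} with hS
  have hSc : IsClosed S := isClosed_Ici.inter (isClosed_eq (by fun_prop) continuous_const)
  have hSb : BddBelow S := ⟨0, fun _ h => h.1⟩
  obtain ⟨β, hβS, hβ⟩ : ∃ β ∈ S, ∀ τ, 0 ≤ τ → τ < β → φ (z + τ • v) ≠ 0 := by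
    obtain ⟨τ, hτ⟩ := hall
    exact ⟨sInf S, hSc.csInf_mem ⟨τ, hτ⟩ hSb, fun τ hτ h h' => h.not_ge (csInf_le hSb ⟨hτ, h'⟩)⟩
  have hβ0 : 0 < β := lt_of_le_of_ne hβS.1 (by
    rintro rfl
    exact hz (by simpa using hβS.2))
  have hfree : ∀ τ, 0 ≤ τ → τ < β → τ ∈ freeTimes φ v z := fun τ hτ h σ hσ => by
    rw [uIcc_of_le hτ] at hσ
    exact hβ σ hσ.1 (hσ.2.trans_lt h)
  obtain ⟨C, hC0, hC⟩ : ∃ C > 0, ∀ᶠ σ in 𝓝 β, φ (z + σ • v) ≤ C * |σ - β| := by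
    have hd : DifferentiableAt ℝ (fun σ : ℝ => φ (z + σ • v)) β :=
      ((hφ.differentiable (by simp)).comp (by fun_prop : Differentiable ℝ fun σ : ℝ => z + σ • v)) β
    obtain ⟨C, hC0, hC⟩ := hd.isBigO_sub.exists_pos
    refine ⟨C, hC0, hC.bound.mono fun σ hσ => ?_⟩
    have h2 : φ (z + β • v) = 0 := hβS.2
    simpa [h2, abs_of_nonneg (h0 _)] using hσ
  obtain ⟨σ₀, hσ₀, hCσ⟩ : ∃ σ₀ ∈ Ico 0 β, ∀ σ ∈ Ico σ₀ β, φ (z + σ • v) ≤ C * (β - σ) := by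
    obtain ⟨l, hl, hlb⟩ := exists_Ioc_subset_of_mem_nhds hC ⟨β - 1, by simp⟩
    obtain ⟨σ₀, h₁, h₂⟩ := exists_between (max_lt hl hβ0)
    refine ⟨σ₀, ⟨(le_max_right _ _).trans h₁.le, h₂⟩, fun σ hσ => ?_⟩
    have : φ (z + σ • v) ≤ C * |σ - β| := hlb ⟨((le_max_left _ _).trans_lt h₁).trans_le hσ.1, hσ.2.le⟩
    rwa [abs_sub_comm, abs_of_pos (sub_pos.2 hσ.2)] at this
  have hder : ∀ σ ∈ Ico σ₀ β, HasDerivAt (fun σ => C * transitTime φ v z σ + Real.log (β - σ))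
      (C * (φ (z + σ • v))⁻¹ + (-1) / (β - σ)) σ := fun σ hσ =>
    ((hasDerivAt_transitTime hc (hfree σ (hσ₀.1.trans hσ.1) hσ.2)).const_mul C).add
      (((hasDerivAt_id σ).const_sub β).log (sub_pos.2 hσ.2).ne')
  have hmono : MonotoneOn (fun σ => C * transitTime φ v z σ + Real.log (β - σ)) (Ico σ₀ β) := by
    refine monotoneOn_of_deriv_nonneg (convex_Ico _ _)
      (fun σ hσ => (hder σ hσ).continuousAt.continuousWithinAt)
      (fun σ hσ => (hder σ (interior_subset hσ)).differentiableAt.differentiableWithinAt)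
      fun σ hσ => ?_
    have hσ := interior_subset hσ
    have hpos := (h0 _).lt_of_ne' (hβ σ (hσ₀.1.trans hσ.1) hσ.2)
    have hb := sub_pos.2 hσ.2
    rw [(hder σ hσ).deriv, neg_div, ← sub_eq_add_neg, sub_nonneg, ← div_eq_mul_inv,
      div_le_div_iff₀ hb hpos, one_mul]
    exact hCσ σ hσ
  have hlim : Tendsto (fun σ => Real.log (β - σ)) (𝓝[<] β) atBot := by
    refine Real.tendsto_log_nhdsGT_zero.comp (tendsto_nhdsWithin_iff.2 ⟨?_, ?_⟩)
    · have : Tendsto (fun σ => β - σ) (𝓝 β) (𝓝 (β - β)) := by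
        exact (continuous_const.sub continuous_id).tendsto β
      simpa using this.mono_left nhdsWithin_le_nhds
    · filter_upwards [self_mem_nhdsWithin] with σ hσ using sub_pos.2 (mem_Iio.1 hσ)
  obtain ⟨σ, hσ1, hσ2⟩ := ((hlim.eventually (eventually_le_atBot
    (C * transitTime φ v z σ₀ + Real.log (β - σ₀) - C * T))).and (Ico_mem_nhdsLT hσ₀.2)).exists
  refine ⟨σ, hfree σ (hσ₀.1.trans hσ2.1) hσ2.2, hσ₀.1.trans hσ2.1, ?_⟩
  have := hmono ⟨le_rfl, hσ₀.2⟩ hσ2 hσ2.1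
  simp only at this
  exact le_of_mul_le_mul_left (by linarith) hC0

theorem exists_transitTime_eq_of_nonneg (hφ : ContDiff ℝ ∞ φ) (h0 : ∀ z, 0 ≤ φ z)
    (h1 : ∀ z, φ z ≤ 1) (hz : φ z ≠ 0) (ht : 0 ≤ t) :
    ∃ τ ∈ freeTimes φ v z, 0 ≤ τ ∧ transitTime φ v z τ = t := by
  obtain ⟨τ, hτ, hτ0, hle⟩ := exists_le_transitTime (v := v) hφ h0 h1 hz t
  have hsub : Icc 0 τ ⊆ freeTimes φ v z := by
    rw [← uIcc_of_le hτ0]; exact uIcc_subset_freeTimes (zero_mem_freeTimes hz) hτ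
  obtain ⟨σ, hσ, he⟩ := intermediate_value_Icc hτ0
    ((continuousOn_transitTime hφ.continuous).mono hsub) (show t ∈ Icc _ _ from ⟨by simpa, hle⟩)
  exact ⟨σ, hsub hσ, hσ.1, he⟩

theorem exists_transitTime_eq (hφ : ContDiff ℝ ∞ φ) (h0 : ∀ z, 0 ≤ φ z)
    (h1 : ∀ z, φ z ≤ 1) (hz : φ z ≠ 0) (t : ℝ) :
    ∃ τ ∈ freeTimes φ v z, transitTime φ v z τ = t := by
  rcases le_total 0 t with ht | ht
  · obtain ⟨τ, h, -, h'⟩ := exists_transitTime_eq_of_nonneg (v := v) hφ h0 h1 hz ht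
    exact ⟨τ, h, h'⟩
  · obtain ⟨τ, h, -, h'⟩ := exists_transitTime_eq_of_nonneg (v := -v) hφ h0 h1 hz (neg_nonneg.2 ht)
    exact ⟨-τ, neg_mem_freeTimes_iff.2 h, by rw [transitTime_neg, h', neg_neg]⟩

open Classical in
/-- The distance (in units of `v`) that the flow of `φ • v` covers in time `t`, starting at `z`. -/
noncomputable def flowShift (φ : E → ℝ) (v : E) (t : ℝ) (z : E) : ℝ :=
  -- For smooth `φ` with values in the unit interval, the default `0` is taken only at zeros of `φ`.
  if h : ∃ τ ∈ freeTimes φ v z, transitTime φ v z τ = t then h.choose else 0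

theorem flowShift_spec (hφ : ContDiff ℝ ∞ φ) (h0 : ∀ z, 0 ≤ φ z) (h1 : ∀ z, φ z ≤ 1)
    (hz : φ z ≠ 0) (t : ℝ) : flowShift φ v t z ∈ freeTimes φ v z ∧
      transitTime φ v z (flowShift φ v t z) = t := by
  have h := exists_transitTime_eq (v := v) hφ h0 h1 hz t
  rw [flowShift, dif_pos h]
  exact h.choose_spec

theorem flowShift_eq (hφ : ContDiff ℝ ∞ φ) (h0 : ∀ z, 0 ≤ φ z) (h1 : ∀ z, φ z ≤ 1)
    (hτ : τ ∈ freeTimes φ v z) (ht : transitTime φ v z τ = t) : flowShift φ v t z = τ := by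
  have hz : φ z ≠ 0 := by simpa using ne_zero_of_mem_freeTimes (zero_mem_of_mem_freeTimes hτ)
  have h := flowShift_spec (v := v) hφ h0 h1 hz t
  exact (strictMonoOn_transitTime hφ.continuous h0).injOn h.1 hτ (h.2.trans ht.symm)

theorem flowShift_zero (hφ : ContDiff ℝ ∞ φ) (h0 : ∀ z, 0 ≤ φ z) (h1 : ∀ z, φ z ≤ 1)
    (hz : φ z ≠ 0) : flowShift φ v 0 z = 0 :=
  flowShift_eq hφ h0 h1 (zero_mem_freeTimes hz) transitTime_zero

theorem flowShift_add (hφ : ContDiff ℝ ∞ φ) (h0 : ∀ z, 0 ≤ φ z) (h1 : ∀ z, φ z ≤ 1)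
    (hz : φ z ≠ 0) (s t : ℝ) : flowShift φ v (s + t) z =
      flowShift φ v t z + flowShift φ v s (z + flowShift φ v t z • v) := by
  obtain ⟨h₁, h₂⟩ := flowShift_spec (v := v) hφ h0 h1 hz t
  obtain ⟨h₃, h₄⟩ := flowShift_spec (v := v) hφ h0 h1 (ne_zero_of_mem_freeTimes h₁) s
  have h₅ := (add_mem_freeTimes_iff h₁).2 h₃
  refine flowShift_eq hφ h0 h1 h₅ ?_
  rw [transitTime_add hφ.continuous h₁ h₅, h₂, h₄, add_comm]

theorem ContinuousLinearMap.isInvertible_of_apply_one_ne_zero {L : ℝ →L[ℝ] ℝ} (h : L 1 ≠ 0) :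
    L.IsInvertible :=
  ⟨ContinuousLinearEquiv.unitsEquivAut ℝ (Units.mk0 _ h), by ext; simp⟩

/-- Implicit function theorem for `transitTime φ v z τ = t`, whose derivative in `τ` is `(φ (z + τ •
v))⁻¹ ≠ 0`. Strict monotonicity identifies the implicit solution with `flowShift` as long as it
stays among the free times. -/
theorem contDiffAt_flowShift [CompleteSpace E] (hφ : ContDiff ℝ ∞ φ) (h0 : ∀ z, 0 ≤ φ z)
    (h1 : ∀ z, φ z ≤ 1) (hz : φ z ≠ 0) (t : ℝ) :
    ContDiffAt ℝ ∞ (fun p : ℝ × E => flowShift φ v p.1 p.2) (t, z) := by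
  obtain ⟨h₁, h₂⟩ := flowShift_spec (v := v) hφ h0 h1 hz t
  set τ := flowShift φ v t z with hτ
  set f : (ℝ × E) × ℝ → ℝ := fun p => transitTime φ v p.1.2 p.2 - p.1.1 with hf
  have hfc : ContDiffAt ℝ ∞ f ((t, z), τ) := by
    refine ContDiffAt.sub ?_ (by fun_prop)
    exact ContDiffAt.comp (g := fun p : E × ℝ => transitTime φ v p.1 p.2)
      (f := fun p : (ℝ × E) × ℝ => (p.1.2, p.2)) _ (contDiffAt_transitTime hφ h₁) (by fun_prop)
  have hinv : (fderiv ℝ f ((t, z), τ) ∘L .inr ℝ (ℝ × E) ℝ).IsInvertible := by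
    apply ContinuousLinearMap.isInvertible_of_apply_one_ne_zero
    have hd : HasDerivAt (fun s => f ((t, z), s))
        ((fderiv ℝ f ((t, z), τ) ∘L .inr ℝ (ℝ × E) ℝ) 1) τ :=
      ((hfc.differentiableAt (by simp)).hasFDerivAt.comp τ (hasFDerivAt_prodMk_right _ τ)).hasDerivAt
    rw [hd.unique ((hasDerivAt_transitTime hφ.continuous h₁).sub_const t)]
    exact inv_ne_zero (ne_zero_of_mem_freeTimes h₁)
  have hψ := hfc.contDiffAt_implicitFunction (by simp) hinv
  have hself : hfc.implicitFunction (by simp) hinv (t, z) = τ :=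
    hfc.implicitFunction_apply_self (by simp) hinv
  refine hψ.congr_of_eventuallyEq ?_
  have hopen : ∀ᶠ x in 𝓝 (t, z), hfc.implicitFunction (by simp) hinv x ∈ freeTimes φ v x.2 := by
    refine (continuousAt_snd.prodMk hψ.continuousAt).eventually
      ((isOpen_setOf_mem_freeTimes (v := v) hφ.continuous).mem_nhds ?_)
    simpa [hself] using h₁
  filter_upwards [hopen, hfc.eventually_apply_implicitFunction (by simp) hinv] with x hx hx'
  refine flowShift_eq hφ h0 h1 hx ?_
  have : f ((t, z), τ) = 0 := sub_eq_zero.2 h₂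
  rw [this] at hx'
  exact sub_eq_zero.1 hx'

end SlowFlow

/-! ### Minimality of the time-one map of a flow -/

/-- Projection along a compact factor is a closed map. -/
theorem isClosed_setOf_exists_mem_Icc {Y : Type*} [TopologicalSpace Y] {Z : Set (ℝ × Y)}
    (hZ : IsClosed Z) (a b : ℝ) : IsClosed {y | ∃ t ∈ Icc a b, (t, y) ∈ Z} := by
  have h := isClosedMap_snd_of_compactSpace (X := Icc a b) (Y := Y) _
    (hZ.preimage (f := fun p : Icc a b × Y => ((p.1 : ℝ), p.2)) (by fun_prop))
  convert h using 1
  ext y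
  simp

namespace Flow

variable {Y : Type*} [TopologicalSpace Y] (Φ : Flow ℝ Y)

theorem map_neg_map (t : ℝ) (y : Y) : Φ (-t) (Φ t y) = y := by
  rw [← Φ.map_add, neg_add_cancel, Φ.map_zero_apply]

theorem map_comm (s t : ℝ) (y : Y) : Φ s (Φ t y) = Φ t (Φ s y) := by
  rw [← Φ.map_add, add_comm, Φ.map_add]

/-- Every nonempty closed set that is invariant under the time-one map contains a minimal one,
provided some compact set meets all flow orbits. -/
theorem exists_minimal_subset [T2Space Y] {K : Set Y} (hK : IsCompact K)
    (hKΦ : ∀ y, ∃ t, Φ t y ∈ K) {M₀ : Set Y} (h₀c : IsClosed M₀) (h₀n : M₀.Nonempty)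
    (h₀i : ∀ n : ℤ, ∀ y ∈ M₀, Φ n y ∈ M₀) :
    ∃ M ⊆ M₀, IsClosed M ∧ M.Nonempty ∧ (∀ n : ℤ, ∀ y ∈ M, Φ n y ∈ M) ∧
      ∀ N ⊆ M, IsClosed N → N.Nonempty → (∀ n : ℤ, ∀ y ∈ N, Φ n y ∈ N) → N = M := by
  -- If `y` reaches `K` at time `t`, then at the integer time `⌊t⌋` it is less than one unit of time
  -- before `K`. Hence the compact set `K'` meets every nonempty invariant set, and intersections of
  -- chains stay nonempty.
  set K' : Set Y := (fun p : ℝ × Y => Φ (-p.1) p.2) '' (Icc (0 : ℝ) 1 ×ˢ K) with hK'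
  have hK'c : IsCompact K' := (isCompact_Icc.prod hK).image (by fun_prop)
  have hmeet : ∀ N : Set Y, N.Nonempty → (∀ n : ℤ, ∀ y ∈ N, Φ n y ∈ N) → (N ∩ K').Nonempty := by
    rintro N ⟨y, hy⟩ hN
    obtain ⟨t, ht⟩ := hKΦ y
    refine ⟨Φ ⌊t⌋ y, hN _ y hy, (Int.fract t, Φ t y),
      ⟨⟨Int.fract_nonneg t, (Int.fract_lt_one t).le⟩, ht⟩, ?_⟩
    simp only
    rw [← Φ.map_add]
    congr 2
    rw [Int.fract]; ring
  obtain ⟨M, hM⟩ := zorn_superset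
    {N : Set Y | N ⊆ M₀ ∧ IsClosed N ∧ N.Nonempty ∧ ∀ n : ℤ, ∀ y ∈ N, Φ n y ∈ N} (by
      intro c hc hchain
      rcases c.eq_empty_or_nonempty with rfl | hne
      · exact ⟨M₀, ⟨Subset.rfl, h₀c, h₀n, h₀i⟩, by simp⟩
      refine ⟨⋂₀ c, ⟨?_, isClosed_sInter fun s hs => (hc hs).2.1, ?_, ?_⟩,
        fun s hs => sInter_subset_of_mem hs⟩
      · obtain ⟨s, hs⟩ := hne
        exact (sInter_subset_of_mem hs).trans (hc hs).1
      · have := hne.to_subtype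
        have hn := IsCompact.nonempty_iInter_of_directed_nonempty_isCompact_isClosed
          (fun s : c => (s : Set Y) ∩ K') (fun s s' => by
            rcases hchain.total s.2 s'.2 with h | h
            · exact ⟨s, Subset.rfl, inter_subset_inter_left _ h⟩
            · exact ⟨s', inter_subset_inter_left _ h, Subset.rfl⟩)
          (fun s => hmeet s (hc s.2).2.2.1 (hc s.2).2.2.2)
          (fun s => hK'c.inter_left (hc s.2).2.1)
          (fun s => (hc s.2).2.1.inter hK'c.isClosed)
        obtain ⟨y, hy⟩ := hn
        exact ⟨y, fun s hs => (mem_iInter.1 hy ⟨s, hs⟩).1⟩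
      · exact fun n y hy s hs => (hc hs).2.2.2 n y (hy s hs))
  obtain ⟨hM₀, hMc, hMn, hMi⟩ := hM.prop
  refine ⟨M, hM₀, hMc, hMn, hMi, fun N hN hNc hNn hNi => hN.antisymm ?_⟩
  exact hM.le_of_le ⟨hN.trans hM₀, hNc, hNn, hNi⟩ hN

/-- If all orbits of a flow are dense, some compact set meets all of them, and the flow has no
nonconstant continuous eigenfunctions, then all orbits of the time-one map are dense. -/
theorem dense_range_int [T2Space Y] (hdense : ∀ y, Dense (range fun t => Φ t y)) {K : Set Y}
    (hK : IsCompact K) (hKΦ : ∀ y, ∃ t, Φ t y ∈ K)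
    (heig : ∀ κ : ℝ, κ ≠ 0 → ∀ h : Y → Circle, Continuous h →
      ¬ ∀ t y, h (Φ t y) = Circle.exp (κ * t) * h y) (y : Y) :
    Dense (range fun n : ℤ => Φ n y) := by
  have hinv : ∀ n : ℤ, ∀ x ∈ closure (range fun n : ℤ => Φ n y),
      Φ n x ∈ closure (range fun n : ℤ => Φ n y) := by
    intro n x hx
    refine map_mem_closure (Φ.continuous_toFun n) hx ?_
    rintro _ ⟨m, rfl⟩
    exact ⟨n + m, by simp [Φ.map_add]⟩
  obtain ⟨M, hMsub, hMc, ⟨m, hm⟩, hMi, hMmin⟩ := Φ.exists_minimal_subset hK hKΦ isClosed_closure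
    (range_nonempty _).closure hinv
  suffices hM : M = univ by
    rw [dense_iff_closure_eq, ← univ_subset_iff, ← hM]
    exact hMsub
  -- Since `Φ t` commutes with the time-one map, the part of `M` that it sends into `M` is closed
  -- and invariant; by minimality it is empty or all of `M`.
  have hstep : ∀ t, ∀ x ∈ M, Φ t x ∈ M → ∀ x ∈ M, Φ t x ∈ M := by
    intro t x hx hxt x' hx'
    have := hMmin (M ∩ Φ t ⁻¹' M) inter_subset_left (hMc.inter (hMc.preimage (by fun_prop)))
      ⟨x, hx, hxt⟩ (fun n z hz => ⟨hMi n z hz.1, by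
        rw [mem_preimage, Φ.map_comm]; exact hMi n _ hz.2⟩)
    exact (this.ge hx').2
  set G : AddSubgroup ℝ :=
    { carrier := {t | Φ t m ∈ M}
      zero_mem' := by simpa using hm
      add_mem' := fun {a b} ha hb => by
        simpa [Φ.map_add] using hstep a m hm ha _ hb
      neg_mem' := fun {a} ha => by
        refine hstep (-a) _ ha ?_ m hm
        rwa [Φ.map_neg_map] } with hG
  have hGmem : ∀ t x, x ∈ M → Φ t x ∈ M → t ∈ G := fun t x hx hxt => hstep t x hx hxt m hm
  have hGc : IsClosed (G : Set ℝ) := hMc.preimage (f := fun t => Φ t m) (by fun_prop)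
  have hG1 : (1 : ℝ) ∈ G := show Φ 1 m ∈ M by simpa using hMi 1 m hm
  rcases G.dense_or_cyclic with hd | ⟨a, ha⟩
  · have hGu : ∀ t, Φ t m ∈ M := fun t => by
      have : t ∈ (G : Set ℝ) := by rw [← hGc.closure_eq, hd.closure_eq]; trivial
      exact this
    rw [← univ_subset_iff, ← (hdense m).closure_eq]
    exact hMc.closure_subset_iff.2 (range_subset_iff.2 hGu)
  exfalso
  have hmemG : ∀ t, t ∈ G ↔ ∃ n : ℤ, n * a = t := fun t => by
    rw [ha, AddSubgroup.mem_closure_singleton]; simp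
  have ha0 : a ≠ 0 := by
    rintro rfl
    obtain ⟨n, hn⟩ := (hmemG 1).1 hG1
    simp at hn
  -- The points that enter `M` within time `1` form a closed set containing the dense orbit of `m`.
  have hex : ∀ x, ∃ t ∈ Icc (0 : ℝ) 1, Φ t x ∈ M := by
    have hcl := isClosed_setOf_exists_mem_Icc
      (hMc.preimage (f := fun p : ℝ × Y => Φ p.1 p.2) (by fun_prop)) 0 1
    have hsub : (range fun t => Φ t m) ⊆
        {x | ∃ t ∈ Icc (0 : ℝ) 1, (t, x) ∈ (fun p : ℝ × Y => Φ p.1 p.2) ⁻¹' M} := by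
      rintro _ ⟨s, rfl⟩
      refine ⟨⌈s⌉ - s, ⟨sub_nonneg.2 (Int.le_ceil s), by linarith [Int.ceil_lt_add_one s]⟩, ?_⟩
      simpa [← Φ.map_add] using hMi ⌈s⌉ m hm
    intro x
    have : x ∈ closure (range fun t => Φ t m) := hdense m x
    exact hcl.closure_subset_iff.2 hsub this
  choose T hT hTM using hex
  -- Two entry times of one point differ by a multiple of `a`, so the phase does not depend on the
  -- choice of `T`.
  have hexp : ∀ s t x, Φ s x ∈ M → Φ t x ∈ M →
      Circle.exp (-(2 * Real.pi / a) * s) = Circle.exp (-(2 * Real.pi / a) * t) := by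
    intro s t x hs ht
    obtain ⟨n, hn⟩ := (hmemG (t - s)).1 (hGmem (t - s) _ hs (by
      rw [← Φ.map_add, sub_add_cancel]; exact ht))
    refine Circle.exp_eq_exp.2 ⟨n, ?_⟩
    have : s = t - n * a := by linarith
    rw [this]
    field_simp
    ring
  refine heig (2 * Real.pi / a) (by positivity) (fun x => Circle.exp (-(2 * Real.pi / a) * T x)) ?_ ?_
  -- The preimage of a closed set is the projection of a closed set of pairs (entry time, point),
  -- although `T` itself need not be continuous.
  · refine continuous_iff_isClosed.2 fun C hC => ?_
    have hcl := isClosed_setOf_exists_mem_Icc (Z := {p : ℝ × Y | Φ p.1 p.2 ∈ M ∧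
      Circle.exp (-(2 * Real.pi / a) * p.1) ∈ C})
      ((hMc.preimage (f := fun p : ℝ × Y => Φ p.1 p.2) (by fun_prop)).inter
        (hC.preimage (f := fun p : ℝ × Y => Circle.exp (-(2 * Real.pi / a) * p.1)) (by fun_prop))) 0 1
    convert hcl using 1
    ext x
    constructor
    · exact fun hx => ⟨T x, hT x, hTM x, hx⟩
    · rintro ⟨t, -, ht, htC⟩
      rw [mem_preimage, hexp (T x) t x (hTM x) ht]
      exact htC
  · intro t x
    have := hexp (T (Φ t x) + t) (T x) x (by rw [Φ.map_add]; exact hTM _) (hTM x)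
    rw [← this, ← Circle.exp_add]
    congr 1
    ring

end Flow

/-! ### The torus -/

/-- The universal covering of the torus. -/
noncomputable def torusExp (z : ℝ × ℝ) : Torus := (Circle.exp z.1, Circle.exp z.2)

/-- A set-theoretic section of `torusExp`. -/
noncomputable def torusArg (y : Torus) : ℝ × ℝ := (Complex.arg y.1, Complex.arg y.2)

theorem torusExp_torusArg (y : Torus) : torusExp (torusArg y) = y := by
  simp [torusExp, torusArg]

theorem torusExp_add (z w : ℝ × ℝ) : torusExp (z + w) = torusExp z * torusExp w := by
  simp [torusExp, Circle.exp_add]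

theorem torusExp_zero : torusExp 0 = 1 := by simp [torusExp]

theorem torusExp_neg (z : ℝ × ℝ) : torusExp (-z) = (torusExp z)⁻¹ := by
  rw [eq_inv_iff_mul_eq_one, ← torusExp_add, neg_add_cancel, torusExp_zero]

theorem continuous_torusExp : Continuous torusExp := by
  unfold torusExp; fun_prop

theorem Circle.countable_preimage_exp (c : Circle) : (Circle.exp ⁻¹' {c}).Countable := by
  refine (countable_range fun m : ℤ => Complex.arg c + m * (2 * Real.pi)).mono fun x hx => ?_
  have h : Circle.exp x = Circle.exp (Complex.arg c) := by rw [Circle.exp_arg]; exact hx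
  obtain ⟨m, hm⟩ := Circle.exp_eq_exp.1 h
  exact ⟨m, hm.symm⟩

theorem countable_preimage_torusExp (F : Finset Torus) :
    (torusExp ⁻¹' (F : Set Torus)).Countable := by
  have : torusExp ⁻¹' (F : Set Torus) =
      ⋃ p ∈ F, (Circle.exp ⁻¹' {p.1}) ×ˢ (Circle.exp ⁻¹' {p.2}) := by
    ext z
    simp only [mem_preimage, Finset.mem_coe, mem_iUnion, mem_prod, mem_singleton_iff, exists_prop]
    exact ⟨fun h => ⟨_, h, rfl, rfl⟩, fun ⟨p, hp, h1, h2⟩ => by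
      rwa [torusExp, h1, h2]⟩
  rw [this]
  exact F.countable_toSet.biUnion fun p _ =>
    (Circle.countable_preimage_exp _).prod (Circle.countable_preimage_exp _)

theorem Circle.eventually_exp_ne (a : ℝ) : ∀ᶠ x in 𝓝 a, Circle.exp x = Circle.exp a → x = a := by
  filter_upwards [Metric.ball_mem_nhds a Real.two_pi_pos] with x hx h
  obtain ⟨m, hm⟩ := Circle.exp_eq_exp.1 h
  rw [Metric.mem_ball, Real.dist_eq, hm, add_sub_cancel_left, abs_mul,
    abs_of_pos Real.two_pi_pos] at hx
  have h1 : |(m : ℝ)| < 1 := by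
    by_contra! hcon
    nlinarith [Real.two_pi_pos]
  have h2 : m = 0 := by
    rw [← Int.abs_lt_one_iff]
    exact_mod_cast h1
  simpa [h2] using hm

theorem eventually_torusExp_notMem (F : Finset Torus) (z : ℝ × ℝ) :
    ∀ᶠ w in 𝓝 z, w ≠ z → torusExp w ∉ F := by
  classical
  have h1 : ∀ᶠ w in 𝓝 z, torusExp w ∉ F.erase (torusExp z) :=
    continuous_torusExp.continuousAt.eventually
      ((F.erase (torusExp z)).finite_toSet.isClosed.isOpen_compl.mem_nhds (by simp))
  have h2 := continuous_fst.continuousAt.eventually (Circle.eventually_exp_ne z.1)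
  have h3 := continuous_snd.continuousAt.eventually (Circle.eventually_exp_ne z.2)
  filter_upwards [h1, h2, h3] with w hw1 hw2 hw3 hne hmem
  refine hw1 (Finset.mem_erase.2 ⟨fun he => hne ?_, hmem⟩)
  simp only [torusExp, Prod.mk.injEq] at he
  exact Prod.ext (hw2 he.1) (hw3 he.2)

theorem Circle.denseRange_exp_pow {α : ℝ} (hα : Irrational α) :
    DenseRange fun n : ℕ => Circle.exp (2 * Real.pi * α) ^ n := by
  refine denseRange_zpow_iff_pow.1 ?_
  have h := (AddCircle.denseRange_zsmul_coe_iff (a := 2 * Real.pi * α) (p := 2 * Real.pi)).2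
    (by rwa [mul_div_cancel_left₀ _ Real.two_pi_pos.ne'])
  have h' := AddCircle.homeomorphCircle'.surjective.denseRange.comp h
    AddCircle.homeomorphCircle'.continuous
  convert h' using 1
  ext1 n
  simp only [Function.comp_apply]
  rw [← AddCircle.coe_zsmul, AddCircle.homeomorphCircle'_apply_mk, zsmul_eq_mul,
    Circle.exp_intCast_mul]

/-- Move to the vertical circle through `u`, then go around: each turn of length `2π` rotates that
circle by the angle `2πα`, and the forward orbits of an irrational rotation are dense. The extra
`2π` in `τ₀` makes it nonnegative. -/
theorem exists_nonneg_torusExp_smul_mem {α : ℝ} (hα : Irrational α) (y : Torus) {U : Set Torus}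
    (hU : IsOpen U) (hne : U.Nonempty) : ∃ τ : ℝ, 0 ≤ τ ∧ y * torusExp (τ • (1, α)) ∈ U := by
  obtain ⟨u, hu⟩ := hne
  set τ₀ : ℝ := Complex.arg (u.1 / y.1 : Circle) + 2 * Real.pi with hτ₀
  have hτ₀0 : 0 ≤ τ₀ := by
    have := Complex.neg_pi_lt_arg (u.1 / y.1 : Circle)
    linarith [Real.pi_pos]
  obtain ⟨n, hn⟩ := (Circle.denseRange_exp_pow hα).exists_mem_open
    (s := {w | (u.1, y.2 * Circle.exp (τ₀ * α) * w) ∈ U}) (hU.preimage (by fun_prop))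
    ⟨(y.2 * Circle.exp (τ₀ * α))⁻¹ * u.2, by
      rw [mem_ofPred_eq, mul_inv_cancel_left]; exact hu⟩
  refine ⟨τ₀ + n * (2 * Real.pi), by positivity, ?_⟩
  rw [mem_ofPred_eq] at hn
  convert hn using 1
  refine Prod.ext ?_ ?_
  · have : Circle.exp (n * (2 * Real.pi)) = 1 := by
      exact_mod_cast Circle.exp_int_mul_two_pi n
    simp [torusExp, Circle.exp_add, hτ₀, this, -Circle.coe_div]
  · simp only [torusExp, Prod.smul_mk, smul_eq_mul, Prod.snd_mul]
    rw [add_mul, Circle.exp_add, mul_assoc (n : ℝ), Circle.exp_natCast_mul, ← mul_assoc]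

theorem exists_nonpos_torusExp_smul_mem {α : ℝ} (hα : Irrational α) (y : Torus) {U : Set Torus}
    (hU : IsOpen U) (hne : U.Nonempty) : ∃ τ : ℝ, τ ≤ 0 ∧ y * torusExp (τ • (1, α)) ∈ U := by
  obtain ⟨τ, h0, h⟩ := exists_nonneg_torusExp_smul_mem hα y⁻¹ hU.inv hne.inv
  refine ⟨-τ, by simpa, ?_⟩
  rw [neg_smul, torusExp_neg]
  simpa [mul_comm] using h

/-- Every line of slope `α` in the plane meets the lift of `F` at most once. -/
def LinesMeetOnce (F : Finset Torus) (α : ℝ) : Prop :=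
  ∀ (z : ℝ × ℝ) (τ : ℝ), torusExp z ∈ F → torusExp (z + τ • (1, α)) ∈ F → τ = 0

/-- The bad slopes are the rationals and the slopes between two points of the countable lift of `F`.
-/
theorem exists_irrational_linesMeetOnce (F : Finset Torus) :
    ∃ α : ℝ, Irrational α ∧ LinesMeetOnce F α := by
  have hF := countable_preimage_torusExp F
  have hB : (range ((↑) : ℚ → ℝ) ∪ (fun p : (ℝ × ℝ) × (ℝ × ℝ) =>
      (p.2.2 - p.1.2) / (p.2.1 - p.1.1)) ''
      ((torusExp ⁻¹' (F : Set Torus)) ×ˢ (torusExp ⁻¹' (F : Set Torus)))).Countable :=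
    (countable_range _).union ((hF.prod hF).image _)
  obtain ⟨α, hα⟩ := (hB.dense_compl ℝ).nonempty
  simp only [mem_compl_iff, mem_union, not_or] at hα
  refine ⟨α, hα.1, fun z τ hz hz' => ?_⟩
  by_contra hτ
  exact hα.2 ⟨(z, z + τ • (1, α)), ⟨hz, hz'⟩, by simp [hτ]⟩

/-! ### The slowed down irrational flow on a punctured torus -/

/-- A smooth function on the torus that vanishes exactly at the points of `F`. -/
noncomputable def torusSpeed (F : Finset Torus) (y : Torus) : ℝ :=
  -- Chords of the unit circle have length at most `2`, so division by `8` keeps every factor at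
  -- most `1`.
  ∏ p ∈ F, (‖(y.1 : ℂ) - p.1‖ ^ 2 + ‖(y.2 : ℂ) - p.2‖ ^ 2) / 8

variable {F : Finset Torus} {α t : ℝ}

theorem torusSpeed_eq_zero {y : Torus} : torusSpeed F y = 0 ↔ y ∈ F := by
  rw [torusSpeed, Finset.prod_eq_zero_iff]
  constructor
  · rintro ⟨p, hp, h⟩
    have h' : ‖(y.1 : ℂ) - p.1‖ ^ 2 + ‖(y.2 : ℂ) - p.2‖ ^ 2 = 0 := by linarith
    rw [add_eq_zero_iff_of_nonneg (by positivity) (by positivity)] at h'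
    have h1 : y.1 = p.1 := Circle.ext (by simpa [sub_eq_zero] using h'.1)
    have h2 : y.2 = p.2 := Circle.ext (by simpa [sub_eq_zero] using h'.2)
    rwa [show y = p from Prod.ext h1 h2]
  · exact fun h => ⟨y, h, by simp⟩

theorem torusSpeed_nonneg (y : Torus) : 0 ≤ torusSpeed F y :=
  Finset.prod_nonneg fun _ _ => by positivity

theorem torusSpeed_le_one (y : Torus) : torusSpeed F y ≤ 1 := by
  refine Finset.prod_le_one (fun _ _ => by positivity) fun p _ => ?_
  have key : ∀ a b : Circle, ‖(a : ℂ) - b‖ ≤ 2 := fun a b => by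
    refine (norm_sub_le _ _).trans ?_
    simp only [Circle.norm_coe]
    norm_num
  have h1 := key y.1 p.1
  have h2 := key y.2 p.2
  have h3 := norm_nonneg ((y.1 : ℂ) - p.1)
  have h4 := norm_nonneg ((y.2 : ℂ) - p.2)
  nlinarith

/-- The lift of `torusSpeed` to the plane. -/
noncomputable def planeSpeed (F : Finset Torus) (z : ℝ × ℝ) : ℝ := torusSpeed F (torusExp z)

theorem planeSpeed_eq_zero {z : ℝ × ℝ} : planeSpeed F z = 0 ↔ torusExp z ∈ F := torusSpeed_eq_zero

theorem planeSpeed_ne_zero {z : ℝ × ℝ} : planeSpeed F z ≠ 0 ↔ torusExp z ∉ F :=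
  planeSpeed_eq_zero.not

theorem planeSpeed_nonneg (z : ℝ × ℝ) : 0 ≤ planeSpeed F z := torusSpeed_nonneg _

theorem planeSpeed_le_one (z : ℝ × ℝ) : planeSpeed F z ≤ 1 := torusSpeed_le_one _

theorem contDiff_planeSpeed : ContDiff ℝ ∞ (planeSpeed F) := by
  refine contDiff_prod fun p _ => ?_
  simp only [torusExp, Circle.coe_exp]
  have h : ContDiff ℝ ∞ fun x : ℝ => Complex.exp (x * Complex.I) :=
    (Complex.ofRealCLM.contDiff.mul contDiff_const).cexp
  exact (((((h.comp contDiff_fst).sub contDiff_const).norm_sq ℝ)).add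
    ((((h.comp contDiff_snd).sub contDiff_const).norm_sq ℝ))).div_const _

theorem planeSpeed_add_congr {z z' : ℝ × ℝ} (h : torusExp z = torusExp z') (w : ℝ × ℝ) :
    planeSpeed F (z + w) = planeSpeed F (z' + w) := by
  simp only [planeSpeed, torusExp_add, h]

theorem flowShift_planeSpeed_congr {z z' : ℝ × ℝ} (h : torusExp z = torusExp z') (v : ℝ × ℝ)
    (t : ℝ) : flowShift (planeSpeed F) v t z = flowShift (planeSpeed F) v t z' := by
  have h1 : freeTimes (planeSpeed F) v z = freeTimes (planeSpeed F) v z' := by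
    simp only [freeTimes, planeSpeed_add_congr h]
  have h2 : transitTime (planeSpeed F) v z = transitTime (planeSpeed F) v z' := by
    ext τ
    simp only [transitTime, planeSpeed_add_congr h]
  unfold flowShift
  rw [h1, h2]

/-- A local inverse of `torusExp` near `y₀`. -/
noncomputable def torusLog (y₀ y : Torus) : ℝ × ℝ := torusArg y₀ + torusArg (y / y₀)

theorem torusExp_torusLog (y₀ y : Torus) : torusExp (torusLog y₀ y) = y := by
  rw [torusLog, torusExp_add, torusExp_torusArg, torusExp_torusArg, mul_div_cancel]

/-- Division by `c` moves the base point to `1`, away from the branch cut, where `arg` is the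
imaginary part of a smooth logarithm. -/
theorem Circle.contMDiffAt_arg_div (c : Circle) :
    ContMDiffAt (𝓡 1) 𝓘(ℝ, ℝ) ∞ (fun w : Circle => Complex.arg (w / c : Circle)) c := by
  have := finrank_real_complex_fact'
  have h1 : ContMDiff (𝓡 1) 𝓘(ℝ, ℂ) ∞ (fun w : Circle => (w : ℂ)) := contMDiff_coe_sphere
  have h2 : ContMDiffAt (𝓡 1) 𝓘(ℝ, ℂ) ∞ (fun w : Circle => ((w / c : Circle) : ℂ)) c :=
    h1.contMDiffAt.comp c ((contMDiff_id.div contMDiff_const).contMDiffAt)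
  have h3 : ContDiffAt ℝ ∞ Complex.arg ((c / c : Circle) : ℂ) := by
    have h := (Complex.contDiffAt_log (n := ∞) (x := 1) (by simp)).restrict_scalars ℝ
    rw [div_self']
    exact (Complex.imCLM.contDiff.contDiffAt.comp _ h).congr_of_eventuallyEq
      (.of_forall fun x => by simp [Complex.log_im])
  exact h3.contMDiffAt.comp c h2

theorem contMDiffAt_torusLog (y : Torus) :
    ContMDiffAt ((𝓡 1).prod (𝓡 1)) 𝓘(ℝ, ℝ × ℝ) ∞ (torusLog y) y := by
  have h1 := ContMDiffAt.comp y (Circle.contMDiffAt_arg_div y.1)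
    (contMDiff_fst (I := 𝓡 1) (J := 𝓡 1) (n := ∞)).contMDiffAt
  have h2 := ContMDiffAt.comp y (Circle.contMDiffAt_arg_div y.2)
    (contMDiff_snd (I := 𝓡 1) (J := 𝓡 1) (n := ∞)).contMDiffAt
  exact contMDiffAt_const.add (h1.prodMk_space h2)

/-- The distance covered in time `t` by the slowed down linear flow of slope `α`. -/
noncomputable def torusShift (F : Finset Torus) (α t : ℝ) (y : Torus) : ℝ :=
  flowShift (planeSpeed F) (1, α) t (torusArg y)

theorem torusShift_torusExp (z : ℝ × ℝ) :
    torusShift F α t (torusExp z) = flowShift (planeSpeed F) (1, α) t z :=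
  flowShift_planeSpeed_congr (torusExp_torusArg _) _ _

/-- The slowed down linear flow of slope `α`. -/
noncomputable def torusMove (F : Finset Torus) (α t : ℝ) (y : Torus) : Torus :=
  y * torusExp (torusShift F α t y • (1, α))

theorem torusMove_torusExp (z : ℝ × ℝ) : torusMove F α t (torusExp z) =
    torusExp (z + flowShift (planeSpeed F) (1, α) t z • (1, α)) := by
  rw [torusMove, torusShift_torusExp, torusExp_add]

theorem torusMove_transitTime {z : ℝ × ℝ} {τ : ℝ}
    (hτ : τ ∈ freeTimes (planeSpeed F) (1, α) z) :
    torusMove F α (transitTime (planeSpeed F) (1, α) z τ) (torusExp z) =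
      torusExp (z + τ • (1, α)) := by
  rw [torusMove_torusExp, flowShift_eq contDiff_planeSpeed planeSpeed_nonneg planeSpeed_le_one hτ rfl]

theorem torusMove_notMem {y : Torus} (hy : y ∉ F) : torusMove F α t y ∉ F := by
  obtain ⟨z, rfl⟩ : ∃ z, torusExp z = y := ⟨_, torusExp_torusArg y⟩
  rw [torusMove_torusExp, ← planeSpeed_ne_zero]
  exact ne_zero_of_mem_freeTimes (flowShift_spec contDiff_planeSpeed planeSpeed_nonneg
    planeSpeed_le_one (planeSpeed_ne_zero.2 hy) t).1

theorem torusMove_zero {y : Torus} (hy : y ∉ F) : torusMove F α 0 y = y := by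
  obtain ⟨z, rfl⟩ : ∃ z, torusExp z = y := ⟨_, torusExp_torusArg y⟩
  rw [torusMove_torusExp, flowShift_zero contDiff_planeSpeed planeSpeed_nonneg planeSpeed_le_one
    (planeSpeed_ne_zero.2 hy), zero_smul, add_zero]

theorem torusMove_add {y : Torus} (hy : y ∉ F) (s t : ℝ) :
    torusMove F α (s + t) y = torusMove F α s (torusMove F α t y) := by
  obtain ⟨z, rfl⟩ : ∃ z, torusExp z = y := ⟨_, torusExp_torusArg y⟩
  rw [torusMove_torusExp, torusMove_torusExp, torusMove_torusExp,
    flowShift_add contDiff_planeSpeed planeSpeed_nonneg planeSpeed_le_one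
    (planeSpeed_ne_zero.2 hy), add_smul, add_assoc]

/-- The shift does not depend on the lift, so the discontinuous `torusArg` may be replaced by
`torusLog y`, which is smooth at `y`. -/
theorem continuousAt_torusShift {y : Torus} (hy : y ∉ F) (t : ℝ) :
    ContinuousAt (fun p : ℝ × Torus => torusShift F α p.1 p.2) (t, y) := by
  have hz : planeSpeed F (torusLog y y) ≠ 0 := by
    rwa [planeSpeed_ne_zero, torusExp_torusLog]
  have h := (contDiffAt_flowShift (v := (1, α)) contDiff_planeSpeed planeSpeed_nonneg
    planeSpeed_le_one hz t).continuousAt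
  have h' : ContinuousAt (fun p : ℝ × Torus => (p.1, torusLog y p.2)) (t, y) :=
    continuousAt_fst.prodMk (ContinuousAt.comp (g := torusLog y) (x := (t, y))
      (contMDiffAt_torusLog y).continuousAt continuousAt_snd)
  refine (ContinuousAt.comp (x := (t, y)) h h').congr (.of_forall fun p => ?_)
  simp only [Function.comp_apply]
  rw [← torusShift_torusExp, torusExp_torusLog]

theorem contMDiffAt_torusShift {y : Torus} (hy : y ∉ F) (t : ℝ) :
    ContMDiffAt ((𝓡 1).prod (𝓡 1)) 𝓘(ℝ, ℝ) ∞ (torusShift F α t) y := by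
  have hz : planeSpeed F (torusLog y y) ≠ 0 := by
    rwa [planeSpeed_ne_zero, torusExp_torusLog]
  have h : ContDiffAt ℝ ∞ (flowShift (planeSpeed F) (1, α) t) (torusLog y y) :=
    ContDiffAt.comp (g := fun p : ℝ × (ℝ × ℝ) => flowShift (planeSpeed F) (1, α) p.1 p.2)
      (f := fun z => (t, z)) _ (contDiffAt_flowShift (v := (1, α)) contDiff_planeSpeed
      planeSpeed_nonneg planeSpeed_le_one hz t) (by fun_prop)
  refine (h.contMDiffAt.comp y (contMDiffAt_torusLog y)).congr_of_eventuallyEq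
    (.of_forall fun p => ?_)
  simp only [Function.comp_apply]
  rw [← torusShift_torusExp, torusExp_torusLog]

theorem contMDiffAt_torusMove {y : Torus} (hy : y ∉ F) (t : ℝ) :
    ContMDiffAt ((𝓡 1).prod (𝓡 1)) ((𝓡 1).prod (𝓡 1)) ∞ (torusMove F α t) y := by
  have h := contMDiffAt_torusShift (α := α) hy t
  have h1 : ContMDiffAt ((𝓡 1).prod (𝓡 1)) (𝓡 1) ∞
      (fun y => y.1 * Circle.exp (torusShift F α t y)) y :=
    contMDiffAt_fst.mul (contMDiff_circleExp.contMDiffAt.comp y h)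
  have h2 : ContMDiffAt ((𝓡 1).prod (𝓡 1)) (𝓡 1) ∞
      (fun y => y.2 * Circle.exp (torusShift F α t y * α)) y :=
    contMDiffAt_snd.mul (contMDiff_circleExp.contMDiffAt.comp y (h.mul contMDiffAt_const))
  refine (h1.prodMk h2).congr_of_eventuallyEq (.of_forall fun p => ?_)
  refine Prod.ext ?_ ?_ <;> simp [torusMove, torusExp]

/-- The slowed down linear flow of slope `α` on the complement of `F`. -/
noncomputable def puncturedFlow (F : Finset Torus) (α : ℝ) : Flow ℝ (punctured Torus F) where
  toFun t y := ⟨torusMove F α t y, torusMove_notMem y.2⟩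
  cont' := by
    refine Continuous.subtype_mk ?_ _
    refine continuous_iff_continuousAt.2 fun p => ?_
    have h : ContinuousAt (fun q : ℝ × punctured Torus F => torusShift F α q.1 q.2) p :=
      ContinuousAt.comp (g := fun p : ℝ × Torus => torusShift F α p.1 p.2)
        (f := fun q : ℝ × punctured Torus F => (q.1, (q.2 : Torus))) (x := p)
        (continuousAt_torusShift p.2.2 p.1) (by fun_prop)
    have h' : ContinuousAt
        (fun q : ℝ × punctured Torus F => torusShift F α q.1 q.2 • ((1, α) : ℝ × ℝ)) p :=
      h.smul continuousAt_const
    exact ContinuousAt.mul (by fun_prop) (ContinuousAt.comp (g := torusExp) (x := p)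
      continuous_torusExp.continuousAt h')
  map_add' s t y := Subtype.ext (torusMove_add y.2 s t)
  map_zero' y := Subtype.ext (torusMove_zero y.2)

theorem coe_puncturedFlow (y : punctured Torus F) :
    (puncturedFlow F α t y : Torus) = torusMove F α t y := rfl

/-- A forward or backward half-line in the universal covering avoids the punctures. -/
theorem freeTimes_halfLine
    (hline : LinesMeetOnce F α)
    {z : ℝ × ℝ} (hz : torusExp z ∉ F) :
    Ici 0 ⊆ freeTimes (planeSpeed F) (1, α) z ∨ Iic 0 ⊆ freeTimes (planeSpeed F) (1, α) z := by
  by_contra! hcon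
  obtain ⟨⟨a, ha, ha'⟩, b, hb, hb'⟩ := And.intro (not_subset.1 hcon.1) (not_subset.1 hcon.2)
  simp only [freeTimes, mem_ofPred_eq, not_forall, not_not, planeSpeed_eq_zero] at ha' hb'
  obtain ⟨a', ha', hFa⟩ := ha'
  obtain ⟨b', hb', hFb⟩ := hb'
  rw [uIcc_of_le ha] at ha'
  rw [uIcc_of_ge hb] at hb'
  -- Zeros at `b' ≤ 0 ≤ a'` lie on one line, hence coincide, and then `z` itself would lie over `F`.
  have h := hline (z + b' • (1, α)) (a' - b') hFb (by
    rwa [add_assoc, ← add_smul, add_sub_cancel])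
  have : a' = 0 := le_antisymm (by linarith [hb'.2]) ha'.1
  rw [this, zero_smul, add_zero] at hFa
  exact hz hFa

/-- Flow orbits visit every set that all half-lines visit. -/
theorem exists_puncturedFlow_mem
    (hline : LinesMeetOnce F α)
    {U : Set Torus} (y : punctured Torus F)
    (h₁ : ∃ τ : ℝ, 0 ≤ τ ∧ (y : Torus) * torusExp (τ • (1, α)) ∈ U)
    (h₂ : ∃ τ : ℝ, τ ≤ 0 ∧ (y : Torus) * torusExp (τ • (1, α)) ∈ U) :
    ∃ t, (puncturedFlow F α t y : Torus) ∈ U := by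
  have hy : torusExp (torusArg y) ∉ F := by rw [torusExp_torusArg]; exact y.2
  obtain ⟨τ, hτ, hU⟩ : ∃ τ ∈ freeTimes (planeSpeed F) (1, α) (torusArg y),
      (y : Torus) * torusExp (τ • (1, α)) ∈ U := by
    rcases freeTimes_halfLine hline hy with h | h
    · obtain ⟨τ, h0, hU⟩ := h₁
      exact ⟨τ, h h0, hU⟩
    · obtain ⟨τ, h0, hU⟩ := h₂
      exact ⟨τ, h h0, hU⟩
  refine ⟨transitTime (planeSpeed F) (1, α) (torusArg y) τ, ?_⟩
  have := torusMove_transitTime hτ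
  rw [torusExp_torusArg, torusExp_add, torusExp_torusArg] at this
  rwa [coe_puncturedFlow, this]

theorem dense_range_puncturedFlow (hα : Irrational α)
    (hline : LinesMeetOnce F α)
    (y : punctured Torus F) : Dense (range fun t => puncturedFlow F α t y) := by
  refine dense_iff_inter_open.2 fun U hU hne => ?_
  have hU' : IsOpen (Subtype.val '' U : Set Torus) :=
    (punctured Torus F).isOpen.isOpenMap_subtype_val U hU
  obtain ⟨t, u, hu, he⟩ := exists_puncturedFlow_mem hline y
    (exists_nonneg_torusExp_smul_mem hα y hU' (hne.image _))
    (exists_nonpos_torusExp_smul_mem hα y hU' (hne.image _))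
  obtain rfl : u = puncturedFlow F α t y := Subtype.ext he
  exact ⟨_, hu, t, rfl⟩

/-- A circle without punctures meets all orbits of the slowed down flow. -/
theorem exists_isCompact_meets_puncturedFlow
    (hline : LinesMeetOnce F α) :
    ∃ K : Set (punctured Torus F), IsCompact K ∧ ∀ y, ∃ t, puncturedFlow F α t y ∈ K := by
  classical
  have : Infinite (Ioc (-Real.pi) Real.pi) := (Ioc_infinite (by linarith [Real.pi_pos])).to_subtype
  have : Infinite Circle := Infinite.of_injective _ Circle.argEquiv.symm.injective
  obtain ⟨c, hc⟩ := Infinite.exists_notMem_finset (F.image Prod.fst)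
  refine ⟨{y | (y : Torus).1 = c}, ?_, fun y => ?_⟩
  · have himage : (Subtype.val '' {y : punctured Torus F | (y : Torus).1 = c}) = {c} ×ˢ univ := by
      ext p
      simp only [mem_image, mem_ofPred_eq, Subtype.exists, exists_and_right, exists_eq_right,
        mem_prod, mem_singleton_iff, mem_univ, and_true, exists_prop]
      refine ⟨fun h => by grind, fun h => ?_⟩
      have : p ∉ F := fun hp => hc (Finset.mem_image.2 ⟨p, hp, h⟩)
      exact ⟨this, h⟩
    rw [Subtype.isCompact_iff, himage]
    exact isCompact_singleton.prod isCompact_univ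
  · have harg : Circle.exp (Complex.arg (c / (y : Torus).1 : Circle)) = c / (y : Torus).1 :=
      Circle.exp_arg _
    have h1 := Complex.neg_pi_lt_arg (c / (y : Torus).1 : Circle)
    have h2 := Complex.arg_le_pi (c / (y : Torus).1 : Circle)
    refine exists_puncturedFlow_mem (U := {p | p.1 = c}) hline y
      ⟨Complex.arg (c / (y : Torus).1 : Circle) + 2 * Real.pi, by linarith [Real.pi_pos], ?_⟩
      ⟨Complex.arg (c / (y : Torus).1 : Circle) - 2 * Real.pi, by linarith [Real.pi_pos], ?_⟩
    · simp only [mem_ofPred_eq, torusExp, Prod.smul_mk, smul_eq_mul, mul_one, Prod.fst_mul,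
        Circle.exp_add_two_pi, harg, mul_div_cancel]
    · simp only [mem_ofPred_eq, torusExp, Prod.smul_mk, smul_eq_mul, mul_one, Prod.fst_mul,
        Circle.exp_sub_two_pi, harg, mul_div_cancel]

/-- A phase that varies continuously and tends to infinity does not converge on the circle. -/
theorem not_tendsto_circleExp_of_tendsto_atTop {r : ℝ → ℝ} {δ κ : ℝ} (hδ : 0 < δ) (hκ : κ ≠ 0)
    (hr : ContinuousOn r (Ioo 0 δ)) (hlim : Tendsto r (𝓝[>] 0) atTop) (l : Circle) :
    ¬ Tendsto (fun θ => Circle.exp (κ * r θ)) (𝓝[>] 0) (𝓝 l) := by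
  intro h
  -- The antipode of `l` must be avoided near the limit, yet by the intermediate value theorem `r`
  -- takes every large value, including one with exactly this phase.
  have hne : l ≠ Circle.exp Real.pi * l := by
    intro he
    have h1 : Circle.exp Real.pi = 1 := by simpa using he.symm
    have := congrArg (Subtype.val : Circle → ℂ) h1
    norm_num at this
  have hev := h.eventually (isOpen_ne.mem_nhds hne)
  obtain ⟨η, hη, hηs⟩ := mem_nhdsGT_iff_exists_Ioo_subset.1
    (hev.and (Ioo_mem_nhdsGT hδ))
  have hη : 0 < η := hη
  set θ₁ := η / 2
  have hθ₁ : θ₁ ∈ Ioo 0 η := ⟨by positivity, by simp only [θ₁]; linarith⟩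
  have hall : ∀ N, r θ₁ ≤ N → ∃ θ ∈ Ioo 0 η, r θ = N := by
    intro N hN
    obtain ⟨θ₂, hθ₂N, hθ₂⟩ := ((hlim.eventually_ge_atTop N).and (Ioo_mem_nhdsGT hθ₁.1)).exists
    have hsub : Icc θ₂ θ₁ ⊆ Ioo 0 η := fun x hx => ⟨hθ₂.1.trans_le hx.1, hx.2.trans_lt hθ₁.2⟩
    obtain ⟨θ, hθ, he⟩ := intermediate_value_Icc' hθ₂.2.le
      (hr.mono fun x hx => (hηs (hsub hx)).2) (show N ∈ Icc _ _ from ⟨hN, hθ₂N⟩)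
    exact ⟨θ, hsub hθ, he⟩
  set x₀ : ℝ := Complex.arg (Circle.exp Real.pi * l : Circle)
  have hx₀ : Circle.exp x₀ = Circle.exp Real.pi * l := Circle.exp_arg _
  obtain ⟨m, hm⟩ : ∃ m : ℤ, r θ₁ ≤ (x₀ + m * (2 * Real.pi)) / κ := by
    rcases lt_or_gt_of_ne hκ with hκ | hκ
    · refine ⟨⌊(r θ₁ * κ - x₀) / (2 * Real.pi)⌋, ?_⟩
      rw [le_div_iff_of_neg hκ]
      have := (le_div_iff₀ Real.two_pi_pos).1 (Int.floor_le ((r θ₁ * κ - x₀) / (2 * Real.pi)))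
      linarith
    · refine ⟨⌈(r θ₁ * κ - x₀) / (2 * Real.pi)⌉, ?_⟩
      rw [le_div_iff₀ hκ]
      have := (div_le_iff₀ Real.two_pi_pos).1 (Int.le_ceil ((r θ₁ * κ - x₀) / (2 * Real.pi)))
      linarith
  obtain ⟨θ, hθ, he⟩ := hall _ hm
  refine (hηs hθ).1 ?_
  rw [he, mul_div_cancel₀ _ hκ, ← hx₀]
  exact Circle.exp_eq_exp.2 ⟨m, rfl⟩

/-! ### Transit times beside a puncture and the absence of eigenfunctions -/

section Puncture

variable {P : ℝ × ℝ}

/-- Points on a transversal shortly before the puncture `P`. -/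
def preTransversal (α : ℝ) (P : ℝ × ℝ) (θ : ℝ) : ℝ × ℝ := P - (1, α) + (0, θ)

/-- At `θ = 0` the segment meets the lift of `F` only at its midpoint `P`. For small `θ > 0` it
misses `P` too: near `P` because the lift is discrete, elsewhere by continuity, uniformly by
compactness of the segment. -/
theorem eventually_two_mem_freeTimes (hline : LinesMeetOnce F α) (hP : torusExp P ∈ F) :
    ∀ᶠ θ in 𝓝[>] 0, (2 : ℝ) ∈ freeTimes (planeSpeed F) (1, α) (preTransversal α P θ) := by
  have h : ∀ᶠ θ in 𝓝 (0 : ℝ), ∀ σ ∈ Icc (0 : ℝ) 2, 0 < θ →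
      planeSpeed F (preTransversal α P θ + σ • (1, α)) ≠ 0 := by
    refine isCompact_Icc.eventually_forall_of_forall_eventually fun σ _ => ?_
    have hcont : Continuous fun q : ℝ × ℝ => preTransversal α P q.1 + q.2 • ((1, α) : ℝ × ℝ) := by
      unfold preTransversal; fun_prop
    have hbase : preTransversal α P 0 + σ • ((1, α) : ℝ × ℝ) = P + (σ - 1) • (1, α) := by
      rw [preTransversal, show ((0 : ℝ), (0 : ℝ)) = 0 from rfl, sub_smul, one_smul]
      abel
    by_cases hσ : σ = 1
    · subst hσ
      have := (hcont.continuousAt (x := ((0 : ℝ), (1 : ℝ)))).eventually (eventually_torusExp_notMem F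
        (preTransversal α P 0 + (1 : ℝ) • ((1, α) : ℝ × ℝ)))
      rw [hbase] at this
      filter_upwards [this] with q hq hq0
      refine planeSpeed_ne_zero.2 (hq fun he => ?_)
      have h1 := congrArg Prod.fst he
      have h2 := congrArg Prod.snd he
      simp [preTransversal] at h1 h2
      have h3 : q.2 = 1 := by linarith
      rw [h3] at h2
      linarith
    · have hne : planeSpeed F (preTransversal α P 0 + σ • (1, α)) ≠ 0 := by
        rw [hbase, planeSpeed_ne_zero]
        exact fun hmem => hσ (sub_eq_zero.1 (hline P _ hP hmem))
      filter_upwards [((contDiff_planeSpeed.continuous).comp hcont).continuousAt.eventually_ne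
        (x := ((0 : ℝ), σ)) hne] with q hq _ using hq
  filter_upwards [h.filter_mono nhdsWithin_le_nhds, self_mem_nhdsWithin] with θ hθ h0 σ hσ
  rw [uIcc_of_le zero_le_two] at hσ
  exact hθ σ hσ h0

theorem continuous_preTransversal : Continuous (preTransversal α P) := by
  unfold preTransversal; fun_prop

theorem preTransversal_zero : preTransversal α P 0 = P + (-1 : ℝ) • (1, α) := by
  rw [preTransversal, show ((0 : ℝ), (0 : ℝ)) = 0 from rfl, neg_one_smul]
  abel

/-- Passing close by a puncture takes arbitrarily long. -/
theorem tendsto_transitTime_preTransversal (hline : LinesMeetOnce F α) (hP : torusExp P ∈ F) :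
    Tendsto (fun θ => transitTime (planeSpeed F) (1, α) (preTransversal α P θ) 2)
      (𝓝[>] 0) atTop := by
  refine tendsto_atTop.2 fun T => ?_
  have hne : planeSpeed F (preTransversal α P 0) ≠ 0 := by
    rw [preTransversal_zero, planeSpeed_ne_zero]
    intro h
    have := hline P _ hP h
    norm_num at this
  -- On the line through `P` a time of `T + 1` is already spent before the puncture. The spare `1`
  -- survives a small change of `θ`, and continuing to `2` only adds time.
  obtain ⟨s, hs, hs0, hTs⟩ := exists_le_transitTime (v := (1, α)) contDiff_planeSpeed
    planeSpeed_nonneg planeSpeed_le_one hne (T + 1)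
  have hs1 : s < 1 := by
    by_contra! h
    refine hs 1 (by rw [uIcc_of_le hs0]; exact ⟨zero_le_one, h⟩) ?_
    rw [preTransversal_zero, neg_one_smul, one_smul, neg_add_cancel_right, planeSpeed_eq_zero]
    exact hP
  have hcont : ContinuousAt (fun θ => (preTransversal α P θ, s)) 0 :=
    (continuous_preTransversal.prodMk continuous_const).continuousAt
  have h1 : ∀ᶠ θ in 𝓝 0, s ∈ freeTimes (planeSpeed F) (1, α) (preTransversal α P θ) :=
    hcont.eventually ((isOpen_setOf_mem_freeTimes contDiff_planeSpeed.continuous).mem_nhds hs)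
  have h2 : ∀ᶠ θ in 𝓝 0, T < transitTime (planeSpeed F) (1, α) (preTransversal α P θ) s :=
    (ContinuousAt.comp (g := fun p : (ℝ × ℝ) × ℝ => transitTime (planeSpeed F) (1, α) p.1 p.2)
      (f := fun θ => (preTransversal α P θ, s)) (x := 0) (contDiffAt_transitTime contDiff_planeSpeed hs).continuousAt hcont).eventually
      (lt_mem_nhds (by simp only [Function.comp_apply]; linarith))
  filter_upwards [h1.filter_mono nhdsWithin_le_nhds, h2.filter_mono nhdsWithin_le_nhds,
    eventually_two_mem_freeTimes hline hP] with θ hθ1 hθ2 hθ3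
  exact hθ2.le.trans ((strictMonoOn_transitTime contDiff_planeSpeed.continuous
    planeSpeed_nonneg).monotoneOn hθ1 hθ3 (by linarith))

/-- The endpoints of the segments tend to `P - (1, α)` and `P + (1, α)`, which lie off the lift of
`F`, so the quotient of the values of `h` there converges. For an eigenfunction this quotient is
`Circle.exp (κ * r)` with `r` the transit time, contradicting
`not_tendsto_circleExp_of_tendsto_atTop`. -/
theorem puncturedFlow_no_eigenfunction (hline : LinesMeetOnce F α) (hP : torusExp P ∈ F)
    {κ : ℝ} (hκ : κ ≠ 0) {h : punctured Torus F → Circle}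
    (hc : Continuous h) :
    ¬ ∀ t y, h (puncturedFlow F α t y) = Circle.exp (κ * t) * h y := by
  classical
  intro heig
  -- The value `1` on `F` is arbitrary; the extension only allows limits to be taken in the torus.
  set H : Torus → Circle := fun y => if hy : y ∉ F then h ⟨y, hy⟩ else 1 with hH
  have hHc : ContinuousOn H (punctured Torus F) := by
    refine continuousOn_iff_continuous_domRestrict.2 (hc.congr fun y => ?_)
    have hy : (y : Torus) ∉ F := y.2
    simp only [hH, domRestrict_apply, hy, not_false_eq_true, dite_true]
  have hlimH : ∀ g : ℝ → ℝ × ℝ, Continuous g → torusExp (g 0) ∉ F →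
      Tendsto (fun θ => H (torusExp (g θ))) (𝓝[>] 0) (𝓝 (H (torusExp (g 0)))) := by
    intro g hg h0
    have := hHc.continuousAt ((punctured Torus F).isOpen.mem_nhds h0)
    exact (ContinuousAt.comp (f := fun θ => torusExp (g θ)) (x := 0) this
      (continuous_torusExp.comp hg).continuousAt).tendsto.mono_left nhdsWithin_le_nhds
  have hpre := hlimH _ continuous_preTransversal (show torusExp (preTransversal α P 0) ∉ F by
    rw [preTransversal_zero]
    intro h
    have := hline P _ hP h
    norm_num at this)
  have hpost := hlimH (fun θ => preTransversal α P θ + (2 : ℝ) • (1, α))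
    (continuous_preTransversal.add continuous_const) (by
      rw [preTransversal_zero, add_assoc, ← add_smul]
      intro h
      have := hline P _ hP h
      norm_num at this)
  have hfree := eventually_two_mem_freeTimes hline hP
  obtain ⟨δ, hδ, hδs⟩ := mem_nhdsGT_iff_exists_Ioo_subset.1 hfree
  refine not_tendsto_circleExp_of_tendsto_atTop hδ hκ (fun θ hθ => ?_)
    (tendsto_transitTime_preTransversal hline hP) _ ((hpost.div' hpre).congr' ?_)
  · exact ((contDiffAt_transitTime contDiff_planeSpeed (hδs hθ)).continuousAt.comp
      (f := fun θ => (preTransversal α P θ, (2 : ℝ)))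
      (continuous_preTransversal.prodMk continuous_const).continuousAt).continuousWithinAt
  · filter_upwards [hfree] with θ hθ
    have hy : torusExp (preTransversal α P θ) ∉ F := by
      have := hθ 0 left_mem_uIcc
      rwa [zero_smul, add_zero, planeSpeed_ne_zero] at this
    have hy' : torusExp (preTransversal α P θ + (2 : ℝ) • (1, α)) ∉ F :=
      planeSpeed_ne_zero.1 (ne_zero_of_mem_freeTimes hθ)
    have he := heig (transitTime (planeSpeed F) (1, α) (preTransversal α P θ) 2)
      ⟨torusExp (preTransversal α P θ), hy⟩
    have hmove : puncturedFlow F α (transitTime (planeSpeed F) (1, α) (preTransversal α P θ) 2)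
        ⟨torusExp (preTransversal α P θ), hy⟩ =
        ⟨torusExp (preTransversal α P θ + (2 : ℝ) • (1, α)), hy'⟩ :=
      Subtype.ext (torusMove_transitTime hθ)
    rw [hmove] at he
    simp only [hH, hy, hy', not_false_eq_true, dite_true]
    rw [he, mul_div_cancel_right]

end Puncture

theorem exists_slope_dense_range_int {F : Finset Torus} (hF : F.Nonempty) :
    ∃ α : ℝ, ∀ y, Dense (range fun n : ℤ => puncturedFlow F α n y) := by
  obtain ⟨α, hα, hline⟩ := exists_irrational_linesMeetOnce F
  obtain ⟨K, hK, hKm⟩ := exists_isCompact_meets_puncturedFlow hline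
  obtain ⟨p, hp⟩ := hF
  refine ⟨α, (puncturedFlow F α).dense_range_int (dense_range_puncturedFlow hα hline) hK hKm
    fun κ hκ h hc => ?_⟩
  exact puncturedFlow_no_eigenfunction hline (P := torusArg p) (by rwa [torusExp_torusArg]) hκ hc

/-! ### Transfer from the torus to the given surface -/

section Transfer

variable {X : Type*} [TopologicalSpace X] [ChartedSpace (EuclideanSpace ℝ (Fin 2)) X]

/-- The image of a finite subset of a surface under a diffeomorphism to the torus. -/
def imageFinset (e : X ≃ₘ⟮𝓡 2, (𝓡 1).prod (𝓡 1)⟯ Torus) (F : Finset X) : Finset Torus :=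
  F.map e.toEquiv.toEmbedding

theorem apply_mem_imageFinset_iff (e : X ≃ₘ⟮𝓡 2, (𝓡 1).prod (𝓡 1)⟯ Torus) {F : Finset X} {x : X} :
    e x ∈ imageFinset e F ↔ x ∈ F :=
  Finset.mem_map' e.toEquiv.toEmbedding

variable [T2Space X]

/-- A diffeomorphism to the torus restricts to a homeomorphism of punctured surfaces. -/
noncomputable def puncturedHomeomorph (e : X ≃ₘ⟮𝓡 2, (𝓡 1).prod (𝓡 1)⟯ Torus) (F : Finset X) :
    punctured X F ≃ₜ punctured Torus (imageFinset e F) :=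
  e.toHomeomorph.subtype fun _ => (apply_mem_imageFinset_iff e).not.symm

/-- The time-`t` map of the slowed down linear flow, carried over to a punctured surface. -/
noncomputable def surfaceMove (e : X ≃ₘ⟮𝓡 2, (𝓡 1).prod (𝓡 1)⟯ Torus) (F : Finset X) (α t : ℝ)
    (x : punctured X F) : punctured X F :=
  (puncturedHomeomorph e F).symm
    (puncturedFlow (imageFinset e F) α t (puncturedHomeomorph e F x))

theorem surfaceMove_surfaceMove (e : X ≃ₘ⟮𝓡 2, (𝓡 1).prod (𝓡 1)⟯ Torus) (F : Finset X)
    (α s t : ℝ) (x : punctured X F) :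
    surfaceMove e F α s (surfaceMove e F α t x) = surfaceMove e F α (s + t) x := by
  simp [surfaceMove, Flow.map_add]

theorem surfaceMove_zero (e : X ≃ₘ⟮𝓡 2, (𝓡 1).prod (𝓡 1)⟯ Torus) (F : Finset X)
    (α : ℝ) (x : punctured X F) : surfaceMove e F α 0 x = x := by
  simp [surfaceMove]

theorem contMDiff_surfaceMove (e : X ≃ₘ⟮𝓡 2, (𝓡 1).prod (𝓡 1)⟯ Torus) (F : Finset X) (α t : ℝ) :
    ContMDiff (𝓡 2) (𝓡 2) ∞ (surfaceMove e F α t) := by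
  intro x
  -- Smoothness into an open subset may be tested after inclusion, where the map is a composition
  -- defined on all of `X`.
  rw [← ContMDiffAt.subtypeVal_comp_iff]
  have hx : e x ∉ imageFinset e F := (apply_mem_imageFinset_iff e).not.2 x.2
  have h : ContMDiffAt (𝓡 2) (𝓡 2) ∞
      (fun x : X => e.symm (torusMove (imageFinset e F) α t (e x))) x :=
    e.symm.contMDiff.contMDiffAt.comp (x : X)
      ((contMDiffAt_torusMove hx t).comp (x : X) e.contMDiff.contMDiffAt)
  exact h.comp x contMDiff_subtype_val.contMDiffAt

/-- The time-one map of the slowed down linear flow, as a diffeomorphism of a punctured surface. -/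
noncomputable def surfaceDiffeomorph (e : X ≃ₘ⟮𝓡 2, (𝓡 1).prod (𝓡 1)⟯ Torus) (F : Finset X)
    (α : ℝ) : punctured X F ≃ₘ⟮𝓡 2, 𝓡 2⟯ punctured X F where
  toFun := surfaceMove e F α 1
  invFun := surfaceMove e F α (-1)
  left_inv x := by rw [surfaceMove_surfaceMove, neg_add_cancel, surfaceMove_zero]
  right_inv x := by rw [surfaceMove_surfaceMove, add_neg_cancel, surfaceMove_zero]
  contMDiff_toFun := contMDiff_surfaceMove e F α 1
  contMDiff_invFun := contMDiff_surfaceMove e F α (-1)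

theorem surfaceDiffeomorph_zpow_apply (e : X ≃ₘ⟮𝓡 2, (𝓡 1).prod (𝓡 1)⟯ Torus) (F : Finset X)
    (α : ℝ) (n : ℤ) (x : punctured X F) :
    (((surfaceDiffeomorph e F α).toEquiv : Equiv.Perm (punctured X F)) ^ n) x =
      surfaceMove e F α n x := by
  induction n generalizing x with
  | zero => simp [surfaceMove_zero]
  | succ n ih =>
    rw [zpow_add_one, Equiv.Perm.mul_apply, ih]
    push_cast
    exact surfaceMove_surfaceMove e F α n 1 x
  | pred n ih =>
    rw [zpow_sub_one, Equiv.Perm.mul_apply, ih]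
    push_cast
    exact surfaceMove_surfaceMove e F α (-n) (-1) x

end Transfer

theorem theorem1p2 {X : Type*} [TopologicalSpace X] [T2Space X]
    [ChartedSpace (EuclideanSpace ℝ (Fin 2)) X] [IsManifold (𝓡 2) ∞ X]
    (hX : IsGenusOneSurface X) (F : Finset X) (hF : F.Nonempty) :
    ∃ f : punctured X F ≃ₘ⟮𝓡 2, 𝓡 2⟯ punctured X F,
      IsMinimalBijection f.toEquiv := by
  obtain ⟨e⟩ := hX
  obtain ⟨α, hα⟩ := exists_slope_dense_range_int (F := imageFinset e F) (hF.map)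
  refine ⟨surfaceDiffeomorph e F α, fun x => ?_⟩
  simp only [surfaceDiffeomorph_zpow_apply]
  exact (puncturedHomeomorph e F).symm.surjective.denseRange.comp
    (hα (puncturedHomeomorph e F x)) (puncturedHomeomorph e F).symm.continuous
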